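/- Let $M$ be a smooth manifold without boundary (finite-dimensional or, more generally, modelled on a Banach space) with a pseudo-Riemannian metric $g$, i.e. a smooth field of nondegenerate symmetric bilinear forms on the tangent spaces. Let $m:\mathbb{R}_{>0}\times M\to M$ be a smooth free action of the multiplicative group $\mathbb{R}_{>0}$, write $m_\lambda=m(\lambda,\cdot)$, and let $P_x=\frac{d}{dt}m(e^t,x)\big|_{t=0}$ be the vector field it generates. Let $f:M\to\mathbb{R}_{>0}$ be a smooth function and $\alpha\in\mathbb{R}\setminus\{0\}$. Suppose that $(g,f)$ is a homogeneous pair of degree $\alpha$, that is, for all $\lambda>0$, $$m_\lambda^*g=\lambda^\alpha g,\qquad m_\lambda^*f=\lambda^\alpha f,\qquad g(P,\cdot)=df.$$ Fix $l>0$, let $M_l=\{x\in M\mid f(x)=l\}$ (a submanifold with $T_xM_l=\ker (df)_x$), and let $g_l$ be the pullback of $g$ to $M_l$. Let $\beta\in\mathbb{R}$. A function on $M$ is called geodesically convex (resp. concave) with respect to a pseudo-Riemannian metric if its composition with every geodesic of that metric, defined on any open interval, is a convex (resp. concave) function on that interval; here a geodesic of a metric $h$ is a smooth curve satisfying $\nabla^{h}_{\dot\gamma}\dot\gamma=0$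 for the Levi-Civita connection, i.e. in every chart, with $c$ the coordinate expression of the curve, $h_c(\ddot c,w)+(\partial_{\dot c}h)(\dot c,w)-\tfrac12(\partial_w h)(\dot c,\dot c)=0$ for all constant vectors $w$. 1. The function $f$ is geodesically convex with respect to $f^\beta g$ if one of the following conditions holds: - $\beta=-1$; - $-1<\beta\le 1$ and $\alpha g_l$ is positive definite; - $\beta<-1$ and $\alpha g_l$ is negative definite. 2. The function $f$ is geodesically concave with respect to $f^\beta g$ if $\beta\ge 1$ and $\alpha g_l$ is negative definite. -/

import Mathlib

open scoped Manifold ContDiff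

noncomputable section

/-- A pseudo-Riemannian metric on a smooth manifold `M` modelled on `E`: a smooth field of symmetric
nondegenerate bilinear forms on the tangent spaces (no sign condition). -/
structure PseudoRiemannianMetric (E : Type*) [NormedAddCommGroup E] [NormedSpace ℝ E]
    (M : Type*) [TopologicalSpace M] [ChartedSpace E M] [IsManifold 𝓘(ℝ, E) ∞ M] where
  /-- The bilinear form on each tangent space. -/
  inner (x : M) : TangentSpace 𝓘(ℝ, E) x →L[ℝ] TangentSpace 𝓘(ℝ, E) x →L[ℝ] ℝ
  symm (x : M) (u v : TangentSpace 𝓘(ℝ, E) x) : inner x u v = inner x v u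
  nondegenerate (x : M) (u : TangentSpace 𝓘(ℝ, E) x) (hu : ∀ v, inner x u v = 0) : u = 0
  contMDiff : ContMDiff 𝓘(ℝ, E) (𝓘(ℝ, E).prod 𝓘(ℝ, E →L[ℝ] E →L[ℝ] ℝ)) ∞
    (fun x ↦ Bundle.TotalSpace.mk' (E →L[ℝ] E →L[ℝ] ℝ)
      (E := fun y : M ↦ TangentSpace 𝓘(ℝ, E) y →L[ℝ] TangentSpace 𝓘(ℝ, E) y →L[ℝ] ℝ) x (inner x))

/-- A smooth free action of the multiplicative group of positive reals on `M`. The map `act` is only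
relevant for positive values of its first argument. -/
structure FreePosRealAction (E : Type*) [NormedAddCommGroup E] [NormedSpace ℝ E]
    (M : Type*) [TopologicalSpace M] [ChartedSpace E M] where
  /-- The action map `(c, x) ↦ c · x`, for `0 < c`. -/
  act : ℝ → M → M
  one_act (x : M) : act 1 x = x
  mul_act (a b : ℝ) (ha : 0 < a) (hb : 0 < b) (x : M) : act (a * b) x = act a (act b x)
  free (a : ℝ) (ha : 0 < a) (x : M) (hx : act a x = x) : a = 1
  smooth : ContMDiffOn (𝓘(ℝ, ℝ).prod 𝓘(ℝ, E)) 𝓘(ℝ, E) ∞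
    (fun p : ℝ × M ↦ act p.1 p.2) (Set.Ioi (0 : ℝ) ×ˢ Set.univ)

section

variable {E : Type*} [NormedAddCommGroup E] [NormedSpace ℝ E]
  {M : Type*} [TopologicalSpace M] [ChartedSpace E M]

/-- The vector field generated by the action: `P x = d/dt (exp t · x)` at `t = 0`.
(The derivative lives in the tangent space at `exp 0 · x`, which is the point `x`.) -/
def FreePosRealAction.generator (m : FreePosRealAction E M) (x : M) : TangentSpace 𝓘(ℝ, E) x :=
  cast (by rw [Real.exp_zero, m.one_act])
    (mfderiv 𝓘(ℝ, ℝ) 𝓘(ℝ, E) (fun t : ℝ ↦ m.act (Real.exp t) x) 0 (1 : ℝ))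

/-- The tangent space at `x` of the level set of `f` through `x`, i.e. the kernel of the
differential of `f` (used for functions without critical points, so that all level sets are
submanifolds). -/
def levelTangent (f : M → ℝ) (x : M) : Submodule ℝ (TangentSpace 𝓘(ℝ, E) x) :=
  (mfderiv 𝓘(ℝ, E) 𝓘(ℝ, ℝ) f x).ker

variable [IsManifold 𝓘(ℝ, E) ∞ M]

/-- The pair `(g, f)` is homogeneous of degree `α`: `f` is smooth and positive, `α ≠ 0`, both `g`
and `f` are multiplied by `c ^ α` under pullback by the action of `c > 0`, and `g (P, ·) = df`. -/
structure IsHomogeneousPair (m : FreePosRealAction E M) (g : PseudoRiemannianMetric E M)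
    (f : M → ℝ) (α : ℝ) : Prop where
  smooth : ContMDiff 𝓘(ℝ, E) 𝓘(ℝ, ℝ) ∞ f
  pos (x : M) : 0 < f x
  degree_ne_zero : α ≠ 0
  pullback_metric (c : ℝ) (hc : 0 < c) (x : M) (u v : TangentSpace 𝓘(ℝ, E) x) :
    g.inner (m.act c x) (mfderiv 𝓘(ℝ, E) 𝓘(ℝ, E) (m.act c) x u)
      (mfderiv 𝓘(ℝ, E) 𝓘(ℝ, E) (m.act c) x v) = c ^ α * g.inner x u v
  pullback_fun (c : ℝ) (hc : 0 < c) (x : M) : f (m.act c x) = c ^ α * f x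
  metric_generator (x : M) (v : TangentSpace 𝓘(ℝ, E) x) :
    g.inner x (m.generator x) v = mfderiv 𝓘(ℝ, E) 𝓘(ℝ, ℝ) f x v

namespace PseudoRiemannianMetric

/-- The conformal change `φ g` of `g` by a smooth positive function `φ`. -/
def conformal (g : PseudoRiemannianMetric E M) (φ : M → ℝ)
    (hφ : ContMDiff 𝓘(ℝ, E) 𝓘(ℝ, ℝ) ∞ φ) (hpos : ∀ x, 0 < φ x) :
    PseudoRiemannianMetric E M where
  inner x := φ x • g.inner x
  symm x u v := by
    show φ x * g.inner x u v = φ x * g.inner x v u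
    rw [g.symm]
  nondegenerate x u hu := g.nondegenerate x u fun v ↦
    (mul_eq_zero.mp (show φ x * g.inner x u v = 0 from hu v)).resolve_left (hpos x).ne'
  contMDiff := hφ.smul_section g.contMDiff

/-- The pullback of `g` to the level set of `f` through `x`, at the point `x`. -/
def levelForm (g : PseudoRiemannianMetric E M) (f : M → ℝ) (x : M)
    (u v : levelTangent (E := E) f x) : ℝ :=
  g.inner x u.1 v.1

/-- The multiple `a g_l` is positive definite, `g_l` being the pullback of `g` to `{f = l}`. -/
def LevelPosDef (g : PseudoRiemannianMetric E M) (f : M → ℝ) (l a : ℝ) : Prop :=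
  ∀ x, f x = l → ∀ u : levelTangent (E := E) f x, u ≠ 0 → 0 < a * g.levelForm f x u u

/-- The multiple `a g_l` is negative definite, `g_l` being the pullback of `g` to `{f = l}`. -/
def LevelNegDef (g : PseudoRiemannianMetric E M) (f : M → ℝ) (l a : ℝ) : Prop :=
  ∀ x, f x = l → ∀ u : levelTangent (E := E) f x, u ≠ 0 → a * g.levelForm f x u u < 0

/-- The coordinate expression `g_z(u, v)` of the metric in the chart `φ`, for `z` in the target of
`φ` and constant coordinate vectors `u v`. In terms of components, `g_z(e_i, e_j) = g_ij(z)`. -/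
def coord (g : PseudoRiemannianMetric E M) (φ : OpenPartialHomeomorph M E) (u v : E) (z : E) : ℝ :=
  g.inner (φ.symm z) (mfderiv 𝓘(ℝ, E) 𝓘(ℝ, E) φ.symm z u) (mfderiv 𝓘(ℝ, E) 𝓘(ℝ, E) φ.symm z v)

/-- The Christoffel symbol of the first kind of the Levi-Civita connection in the chart `φ`:
`[u v, w] = (∂_u g(v, w) + ∂_v g(u, w) - ∂_w g(u, v)) / 2`, i.e. `g(∇_u v, w)` for vector fields
`u v w` with constant coordinates. -/
def christoffel (g : PseudoRiemannianMetric E M) (φ : OpenPartialHomeomorph M E)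
    (u v w : E) (z : E) : ℝ :=
  (fderiv ℝ (g.coord φ v w) z u + fderiv ℝ (g.coord φ u w) z v - fderiv ℝ (g.coord φ u v) z w) / 2

/-- `γ` is a geodesic of `g` on the open set `J` of parameters: it is smooth on `J`, and
in every smooth chart `φ` its coordinate representation `c = φ ∘ γ` satisfies the geodesic equation
`∇_{c'} c' = 0` for the Levi-Civita connection. The equation is paired with an arbitrary vector
`w`: `g(c'', w) + [c' c', w] = 0`; as `g` is nondegenerate this says
`c''^k + Γ^k_ij c'^i c'^j = 0`. -/
def IsGeodesicOn (g : PseudoRiemannianMetric E M) (γ : ℝ → M) (J : Set ℝ) : Prop :=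
  ContMDiffOn 𝓘(ℝ, ℝ) 𝓘(ℝ, E) ∞ γ J ∧
    ∀ φ ∈ IsManifold.maximalAtlas 𝓘(ℝ, E) ∞ M, ∀ t ∈ J, γ t ∈ φ.source → ∀ w : E,
      g.coord φ (deriv (deriv fun s ↦ φ (γ s)) t) w (φ (γ t)) +
        g.christoffel φ (deriv (fun s ↦ φ (γ s)) t) (deriv (fun s ↦ φ (γ s)) t) w (φ (γ t)) = 0

/-- `F` is geodesically convex with respect to `g`: it is convex along every geodesic of `g` defined
on an open interval. -/
def GeodesicallyConvex (g : PseudoRiemannianMetric E M) (F : M → ℝ) : Prop :=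
  ∀ (J : Set ℝ) (γ : ℝ → M), IsOpen J → J.OrdConnected → g.IsGeodesicOn γ J →
    ConvexOn ℝ J fun t ↦ F (γ t)

/-- `F` is geodesically concave with respect to `g`: it is concave along every geodesic of `g`
defined on an open interval. -/
def GeodesicallyConcave (g : PseudoRiemannianMetric E M) (F : M → ℝ) : Prop :=
  ∀ (J : Set ℝ) (γ : ℝ → M), IsOpen J → J.OrdConnected → g.IsGeodesicOn γ J →
    ConcaveOn ℝ J fun t ↦ F (γ t)

end PseudoRiemannianMetric

/-- The conformal metric `f ^ β g` attached to a homogeneous pair `(g, f)`. -/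
def IsHomogeneousPair.powMetric {m : FreePosRealAction E M} {g : PseudoRiemannianMetric E M}
    {f : M → ℝ} {α : ℝ} (h : IsHomogeneousPair m g f α) (β : ℝ) : PseudoRiemannianMetric E M :=
  g.conformal (fun x ↦ f x ^ β)
    (fun x ↦ ContMDiffAt.comp x
      ((Real.contDiffAt_rpow_const_of_ne (h.pos x).ne').contMDiffAt) (h.smooth x))
    (fun x ↦ Real.rpow_pos_of_pos (h.pos x) β)

end

end

/-! The proof computes the second derivative of f along a geodesic γ of f^β g and reads off its
sign. Since g(P, ·) = df, the first derivative is g(P, γ'). Differentiating once more produces g(P,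
γ''), which the geodesic equation paired with P eliminates. What is left is half the Lie derivative
of g along P, evaluated on γ', plus terms from the conformal factor. Homogeneity gives L_P g = α g
and Euler's relation df(P) = α f, so with X = γ' and r = df(X), f'' = α(1+β)/2 · g(X, X) - β r²/f
(`deriv_deriv_comp_geodesic`).

As df(P) is nonzero, X splits as Y + (r/(αf)) P with df(Y) = 0. The splitting is g-orthogonal,
because g(P, Y) = df(Y) = 0, and g(P, P) = αf. Hence f'' = (1-β)/2 · r²/f + (1+β)/2 · α g(Y, Y)
(`exists_deriv_deriv_comp_geodesic_eq`).

Definiteness is assumed on the level l only. The action carries any level set to that one and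
rescales the induced metric by a positive factor, so the sign of α g(Y, Y) is known everywhere
(`exists_level_transport`). Everything infinitesimal is done in charts, where L_P g = α g follows by
differentiating the pullback identity at c = 1. -/

open scoped Topology

/-! ### Smoothness and Leibniz rule for the metric in a chart. -/

namespace PseudoRiemannianMetric

variable {E : Type*} [NormedAddCommGroup E] [NormedSpace ℝ E]
  {M : Type*} [TopologicalSpace M] [ChartedSpace E M] [IsManifold 𝓘(ℝ, E) ∞ M]
  {φ : OpenPartialHomeomorph M E}

/-- A vector of constant coordinates, transported to `M` by the inverse of a chart, depends
smoothly on the base point and on the vector. -/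
theorem contMDiffAt_mfderiv_chart_symm (hφ : φ ∈ IsManifold.maximalAtlas 𝓘(ℝ, E) ∞ M)
    {F : Type*} [NormedAddCommGroup F] [NormedSpace ℝ F] {a b : F → E} {q : F}
    (ha : ContDiffAt ℝ ∞ a q) (hb : ContDiffAt ℝ ∞ b q) (hq : a q ∈ φ.target) :
    ContMDiffAt 𝓘(ℝ, F) 𝓘(ℝ, E).tangent ∞
      (fun y ↦ (⟨φ.symm (a y), mfderiv 𝓘(ℝ, E) 𝓘(ℝ, E) φ.symm (a y) (b y)⟩ :
        TangentBundle 𝓘(ℝ, E) M)) q := by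
  have h1 : ContMDiffOn 𝓘(ℝ, E).tangent 𝓘(ℝ, E).tangent ∞
      (tangentMapWithin 𝓘(ℝ, E) 𝓘(ℝ, E) φ.symm φ.target)
      (Bundle.TotalSpace.proj ⁻¹' φ.target) :=
    (contMDiffOn_symm_of_mem_maximalAtlas hφ).contMDiffOn_tangentMapWithin le_rfl
      φ.open_target.uniqueMDiffOn
  have hopen : IsOpen ((Bundle.TotalSpace.proj : TangentBundle 𝓘(ℝ, E) E → E) ⁻¹' φ.target) :=
    φ.open_target.preimage (FiberBundle.continuous_proj E (TangentSpace 𝓘(ℝ, E)))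
  have h2 : ContMDiffAt 𝓘(ℝ, F) 𝓘(ℝ, E).tangent ∞
      (fun y ↦ (⟨a y, b y⟩ : TangentBundle 𝓘(ℝ, E) E)) q := by
    rw [Bundle.contMDiffAt_totalSpace]
    exact ⟨ha.contMDiffAt, by simpa using hb.contMDiffAt⟩
  have h3 := (h1.contMDiffAt (x := ⟨a q, b q⟩) (hopen.mem_nhds hq)).comp q h2
  refine h3.congr_of_eventuallyEq ?_
  filter_upwards [ha.continuousAt.preimage_mem_nhds (φ.open_target.mem_nhds hq)] with y hy
  simp only [Function.comp, tangentMapWithin]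
  rw [mfderivWithin_of_isOpen φ.open_target hy]

/-- Joint smoothness in base point and both vectors is what allows the metric to be differentiated
along a moving frame. -/
theorem contDiffAt_coord (g : PseudoRiemannianMetric E M)
    (hφ : φ ∈ IsManifold.maximalAtlas 𝓘(ℝ, E) ∞ M)
    {F : Type*} [NormedAddCommGroup F] [NormedSpace ℝ F] {z a b : F → E} {q : F}
    (hz : ContDiffAt ℝ ∞ z q) (ha : ContDiffAt ℝ ∞ a q) (hb : ContDiffAt ℝ ∞ b q)
    (hq : z q ∈ φ.target) :
    ContDiffAt ℝ ∞ (fun y ↦ g.coord φ (a y) (b y) (z y)) q := by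
  rw [← contMDiffAt_iff_contDiffAt]
  have hb' : ContMDiffAt 𝓘(ℝ, F) 𝓘(ℝ, E) ∞ (fun y ↦ φ.symm (z y)) q :=
    ((contMDiffOn_symm_of_mem_maximalAtlas hφ).contMDiffAt (φ.open_target.mem_nhds hq)).comp q
      hz.contMDiffAt
  have key : ContMDiffAt 𝓘(ℝ, F) (𝓘(ℝ, E).prod 𝓘(ℝ, ℝ)) ∞
      (fun y ↦ Bundle.TotalSpace.mk' ℝ (E := Bundle.Trivial M ℝ) (φ.symm (z y))
        (g.coord φ (a y) (b y) (z y))) q :=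
    ContMDiffAt.clm_bundle_apply₂ (F₁ := E) (F₂ := E)
      (E₁ := fun y : M ↦ TangentSpace 𝓘(ℝ, E) y) (E₂ := fun y : M ↦ TangentSpace 𝓘(ℝ, E) y)
      (E₃ := Bundle.Trivial M ℝ)
      (ContMDiffAt.comp q (g.contMDiff.contMDiffAt (x := φ.symm (z q))) hb')
      (contMDiffAt_mfderiv_chart_symm hφ hz ha hq) (contMDiffAt_mfderiv_chart_symm hφ hz hb hq)
  simp only [Bundle.contMDiffAt_totalSpace] at key
  exact key.2

theorem coord_add_left (g : PseudoRiemannianMetric E M) (u u' v z : E) :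
    g.coord φ (u + u') v z = g.coord φ u v z + g.coord φ u' v z :=
  let T := mfderiv 𝓘(ℝ, E) 𝓘(ℝ, E) φ.symm z
  (congrArg (fun w ↦ g.inner (φ.symm z) w (T v)) (map_add T u u')).trans
    (DFunLike.congr_fun (map_add (g.inner (φ.symm z)) (T u) (T u')) (T v))

theorem coord_smul_left (g : PseudoRiemannianMetric E M) (r : ℝ) (u v z : E) :
    g.coord φ (r • u) v z = r * g.coord φ u v z :=
  let T := mfderiv 𝓘(ℝ, E) 𝓘(ℝ, E) φ.symm z
  (congrArg (fun w ↦ g.inner (φ.symm z) w (T v)) (map_smul T r u)).trans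
    (DFunLike.congr_fun (map_smul (g.inner (φ.symm z)) r (T u)) (T v))

theorem coord_symm (g : PseudoRiemannianMetric E M) (u v z : E) :
    g.coord φ u v z = g.coord φ v u z := g.symm _ _ _

/-- Leibniz rule for the metric evaluated on vector fields along a curve, in a chart. -/
theorem hasDerivAt_coord (g : PseudoRiemannianMetric E M)
    (hφ : φ ∈ IsManifold.maximalAtlas 𝓘(ℝ, E) ∞ M) {z a b : ℝ → E} {z' a' b' : E} {t : ℝ}
    (hz : HasDerivAt z z' t) (ha : HasDerivAt a a' t) (hb : HasDerivAt b b' t)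
    (ht : z t ∈ φ.target) :
    HasDerivAt (fun s ↦ g.coord φ (a s) (b s) (z s))
      (fderiv ℝ (g.coord φ (a t) (b t)) (z t) z' + g.coord φ a' (b t) (z t) +
        g.coord φ (a t) b' (z t)) t := by
  let H : E × E × E → ℝ := fun q ↦ g.coord φ q.2.1 q.2.2 q.1
  have hH : ∀ q : E × E × E, q.1 ∈ φ.target → DifferentiableAt ℝ H q := fun q hq ↦
    (g.contDiffAt_coord hφ contDiffAt_fst (contDiffAt_fst.comp q contDiffAt_snd)
      (contDiffAt_snd.comp q contDiffAt_snd) hq).differentiableAt (by simp)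
  set D := fderiv ℝ H (z t, a t, b t) with hD
  have hHD : HasFDerivAt H D (z t, a t, b t) := (hH _ ht).hasFDerivAt
  have h1 : fderiv ℝ (g.coord φ (a t) (b t)) (z t) z' = D (z', 0, 0) := by
    have : HasFDerivAt (fun y : E ↦ (y, a t, b t)) (ContinuousLinearMap.inl ℝ E (E × E)) (z t) :=
      hasFDerivAt_prodMk_left _ _
    have h := HasFDerivAt.comp (z t) hHD this
    have h' : HasFDerivAt (g.coord φ (a t) (b t)) (D.comp (ContinuousLinearMap.inl ℝ E (E × E)))
      (z t) := h
    rw [h'.fderiv]; rfl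
  -- By linearity in this slot, the restriction to the line `a t + s • a'` is affine in `s`, and its
  -- slope is the partial derivative.
  have h2 : g.coord φ a' (b t) (z t) = D (0, a', 0) := by
    have c : HasDerivAt (fun s : ℝ ↦ (z t, a t + s • a', b t)) (0, a', 0) 0 := by
      refine (hasDerivAt_const _ _).prodMk (HasDerivAt.prodMk ?_ (hasDerivAt_const _ _))
      simpa using ((hasDerivAt_id (0 : ℝ)).smul_const a').const_add (a t)
    have hc : HasFDerivAt H D ((fun s : ℝ ↦ (z t, a t + s • a', b t)) 0) := by simpa using hHD
    have e1 := hc.comp_hasDerivAt 0 c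
    have e2 : HasDerivAt (fun s : ℝ ↦ g.coord φ (a t) (b t) (z t) + s * g.coord φ a' (b t) (z t))
        (g.coord φ a' (b t) (z t)) 0 := by
      simpa using ((hasDerivAt_id (0 : ℝ)).mul_const (g.coord φ a' (b t) (z t))).const_add
        (g.coord φ (a t) (b t) (z t))
    refine e2.unique (e1.congr_of_eventuallyEq (Filter.Eventually.of_forall fun s ↦ ?_))
    simp [H, coord_add_left, coord_smul_left]
  have h3 : g.coord φ (a t) b' (z t) = D (0, 0, b') := by
    have c : HasDerivAt (fun s : ℝ ↦ (z t, a t, b t + s • b')) (0, 0, b') 0 := by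
      refine (hasDerivAt_const _ _).prodMk (HasDerivAt.prodMk (hasDerivAt_const _ _) ?_)
      simpa using ((hasDerivAt_id (0 : ℝ)).smul_const b').const_add (b t)
    have hc : HasFDerivAt H D ((fun s : ℝ ↦ (z t, a t, b t + s • b')) 0) := by simpa using hHD
    have e1 := hc.comp_hasDerivAt 0 c
    have e2 : HasDerivAt (fun s : ℝ ↦ g.coord φ (a t) (b t) (z t) + s * g.coord φ (a t) b' (z t))
        (g.coord φ (a t) b' (z t)) 0 := by
      simpa using ((hasDerivAt_id (0 : ℝ)).mul_const (g.coord φ (a t) b' (z t))).const_add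
        (g.coord φ (a t) (b t) (z t))
    refine e2.unique (e1.congr_of_eventuallyEq (Filter.Eventually.of_forall fun s ↦ ?_))
    simp [H, g.coord_symm (a t), coord_add_left, coord_smul_left]
  have key := hHD.comp_hasDerivAt t (hz.prodMk (ha.prodMk hb))
  have : D (z', a', b') = D (z', 0, 0) + D (0, a', 0) + D (0, 0, b') := by
    rw [← map_add, ← map_add]; simp
  rw [h1, h2, h3, ← this]
  exact key

end PseudoRiemannianMetric

/-! ### The action and its generator in a chart. -/

section Flow

variable {E : Type*} [NormedAddCommGroup E] [NormedSpace ℝ E]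
  {M : Type*} [TopologicalSpace M] [ChartedSpace E M]
  {φ : OpenPartialHomeomorph M E}

/-- All tangent spaces unfold to `E`, so the base point can be changed without casting the vectors.
-/
theorem PseudoRiemannianMetric.inner_congr_base [IsManifold 𝓘(ℝ, E) ∞ M]
    (g : PseudoRiemannianMetric E M) {x y : M} (hxy : x = y) (u v : E) :
    (g.inner x : E →L[ℝ] E →L[ℝ] ℝ) u v = (g.inner y : E →L[ℝ] E →L[ℝ] ℝ) u v := by
  subst hxy; rfl

namespace FreePosRealAction

/-- The action in a chart, as a function of the parameter and of the coordinates of the point. -/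
def flowCoord (m : FreePosRealAction E M) (φ : OpenPartialHomeomorph M E) (p : ℝ × E) : E :=
  φ (m.act p.1 (φ.symm p.2))

/-- The coordinate expression of the generator of the action. -/
noncomputable def generatorCoord (m : FreePosRealAction E M) (φ : OpenPartialHomeomorph M E)
    (z : E) : E :=
  fderiv ℝ (m.flowCoord φ) (1, z) (1, 0)

theorem contMDiffAt_act_prod (m : FreePosRealAction E M) {c : ℝ} (hc : 0 < c) (x : M) :
    ContMDiffAt (𝓘(ℝ, ℝ).prod 𝓘(ℝ, E)) 𝓘(ℝ, E) ∞ (fun p : ℝ × M ↦ m.act p.1 p.2) (c, x) :=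
  m.smooth.contMDiffAt ((isOpen_Ioi.prod isOpen_univ).mem_nhds ⟨hc, trivial⟩)

theorem contMDiff_act (m : FreePosRealAction E M) {c : ℝ} (hc : 0 < c) :
    ContMDiff 𝓘(ℝ, E) 𝓘(ℝ, E) ∞ (m.act c) := fun x ↦
  ContMDiffAt.comp (g := fun p : ℝ × M ↦ m.act p.1 p.2) (f := fun y ↦ (c, y)) x
    (m.contMDiffAt_act_prod hc x) (contMDiffAt_const.prodMk contMDiffAt_id)

theorem flowCoord_one (m : FreePosRealAction E M) {z : E} (hz : z ∈ φ.target) :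
    m.flowCoord φ (1, z) = z := by
  simp [flowCoord, m.one_act, φ.right_inv hz]

theorem contMDiffAt_act_chart_symm (m : FreePosRealAction E M)
    (hφ : φ ∈ IsManifold.maximalAtlas 𝓘(ℝ, E) ∞ M) {c : ℝ} (hc : 0 < c) {z : E}
    (hz : z ∈ φ.target) :
    ContMDiffAt 𝓘(ℝ, ℝ × E) 𝓘(ℝ, E) ∞ (fun p : ℝ × E ↦ m.act p.1 (φ.symm p.2)) (c, z) := by
  have h2 : ContMDiffAt 𝓘(ℝ, ℝ × E) 𝓘(ℝ, E) ∞ (fun p : ℝ × E ↦ φ.symm p.2) (c, z) :=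
    ContMDiffAt.comp (c, z)
      ((contMDiffOn_symm_of_mem_maximalAtlas hφ).contMDiffAt (φ.open_target.mem_nhds hz))
      contDiffAt_snd.contMDiffAt
  exact ContMDiffAt.comp (c, z) (m.contMDiffAt_act_prod hc (φ.symm z))
    (contDiffAt_fst.contMDiffAt.prodMk h2)

theorem contDiffAt_flowCoord (m : FreePosRealAction E M)
    (hφ : φ ∈ IsManifold.maximalAtlas 𝓘(ℝ, E) ∞ M) {c : ℝ} (hc : 0 < c) {z : E}
    (hz : z ∈ φ.target) (hcz : m.act c (φ.symm z) ∈ φ.source) :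
    ContDiffAt ℝ ∞ (m.flowCoord φ) (c, z) :=
  contMDiffAt_iff_contDiffAt.mp (ContMDiffAt.comp (c, z)
    ((contMDiffOn_of_mem_maximalAtlas hφ).contMDiffAt (φ.open_source.mem_nhds hcz))
    (m.contMDiffAt_act_chart_symm hφ hc hz))

theorem contDiffAt_flowCoord_one (m : FreePosRealAction E M)
    (hφ : φ ∈ IsManifold.maximalAtlas 𝓘(ℝ, E) ∞ M) {z : E} (hz : z ∈ φ.target) :
    ContDiffAt ℝ ∞ (m.flowCoord φ) (1, z) :=
  m.contDiffAt_flowCoord hφ one_pos hz (by rw [m.one_act]; exact φ.map_target hz)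

/-- By continuity the flow stays in the chart domain near (c, z). Identities on M thus become
identities of germs in coordinates, which can be differentiated. -/
theorem chart_symm_flowCoord_eventuallyEq (m : FreePosRealAction E M)
    (hφ : φ ∈ IsManifold.maximalAtlas 𝓘(ℝ, E) ∞ M) {c : ℝ} (hc : 0 < c) {z : E}
    (hz : z ∈ φ.target) (hcz : m.act c (φ.symm z) ∈ φ.source) :
    ∀ᶠ p in 𝓝 (c, z), 0 < p.1 ∧ p.2 ∈ φ.target ∧ m.act p.1 (φ.symm p.2) ∈ φ.source ∧
      φ.symm (m.flowCoord φ p) = m.act p.1 (φ.symm p.2) := by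
  have h1 := (m.contMDiffAt_act_chart_symm hφ hc hz).continuousAt.preimage_mem_nhds
    (φ.open_source.mem_nhds hcz)
  have h2 : ∀ᶠ p : ℝ × E in 𝓝 (c, z), 0 < p.1 := continuousAt_fst.eventually (lt_mem_nhds hc)
  have h3 : ∀ᶠ p : ℝ × E in 𝓝 (c, z), p.2 ∈ φ.target :=
    continuousAt_snd.eventually (φ.open_target.mem_nhds hz)
  filter_upwards [h1, h2, h3] with p p1 p2 p3
  exact ⟨p2, p3, p1, φ.left_inv p1⟩

theorem contDiffAt_generatorCoord (m : FreePosRealAction E M)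
    (hφ : φ ∈ IsManifold.maximalAtlas 𝓘(ℝ, E) ∞ M) {z : E} (hz : z ∈ φ.target) :
    ContDiffAt ℝ ∞ (m.generatorCoord φ) z := by
  have h := (m.contDiffAt_flowCoord_one hφ hz).fderiv_right (m := ∞) le_rfl
  exact (h.comp z (contDiffAt_const.prodMk contDiffAt_id)).clm_apply contDiffAt_const

/-- The differential of a chart inverse maps the coordinates of the generator to the generator. -/
theorem mfderiv_chart_symm_generatorCoord (m : FreePosRealAction E M)
    (hφ : φ ∈ IsManifold.maximalAtlas 𝓘(ℝ, E) ∞ M) {z : E} (hz : z ∈ φ.target) :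
    mfderiv 𝓘(ℝ, E) 𝓘(ℝ, E) φ.symm z (m.generatorCoord φ z) = m.generator (φ.symm z) := by
  have hexp : HasDerivAt (fun t : ℝ ↦ (Real.exp t, z)) ((1 : ℝ), (0 : E)) 0 := by
    simpa using (Real.hasDerivAt_exp 0).prodMk (hasDerivAt_const (0 : ℝ) z)
  have hd : HasFDerivAt (m.flowCoord φ) (fderiv ℝ (m.flowCoord φ) (1, z)) (Real.exp 0, z) := by
    rw [Real.exp_zero]
    exact ((m.contDiffAt_flowCoord_one hφ hz).differentiableAt (by simp)).hasFDerivAt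
  have hflow : HasDerivAt (fun t : ℝ ↦ m.flowCoord φ (Real.exp t, z)) (m.generatorCoord φ z) 0 := by
    have := hd.comp_hasDerivAt (0 : ℝ) hexp
    exact this
  have h0 : m.flowCoord φ (Real.exp 0, z) = z := by rw [Real.exp_zero, m.flowCoord_one hz]
  have hs : HasMFDerivAt 𝓘(ℝ, E) 𝓘(ℝ, E) φ.symm z (mfderiv 𝓘(ℝ, E) 𝓘(ℝ, E) φ.symm z) :=
    (((contMDiffOn_symm_of_mem_maximalAtlas hφ).contMDiffAt
      (φ.open_target.mem_nhds hz)).mdifferentiableAt (by simp)).hasMFDerivAt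
  have hs' : HasMFDerivAt 𝓘(ℝ, E) 𝓘(ℝ, E) φ.symm (m.flowCoord φ (Real.exp 0, z))
      (mfderiv 𝓘(ℝ, E) 𝓘(ℝ, E) φ.symm z) := h0.symm ▸ hs
  have hcomp := HasMFDerivAt.comp (0 : ℝ) hs' hflow.hasFDerivAt.hasMFDerivAt
  have hev : (fun t : ℝ ↦ m.act (Real.exp t) (φ.symm z)) =ᶠ[𝓝 0]
      φ.symm ∘ fun t : ℝ ↦ m.flowCoord φ (Real.exp t, z) := by
    have hc : Filter.Tendsto (fun t : ℝ ↦ (Real.exp t, z)) (𝓝 0) (𝓝 (1, z)) := by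
      simpa using hexp.continuousAt.tendsto
    have := hc.eventually (m.chart_symm_flowCoord_eventuallyEq hφ one_pos hz
      (by rw [m.one_act]; exact φ.map_target hz))
    filter_upwards [this] with t ht using ht.2.2.2.symm
  have hfin := (hcomp.congr_of_eventuallyEq hev).mfderiv
  -- The cast in `generator` relates fibres that are definitionally `E`, so it reduces away.
  have hgen : m.generator (φ.symm z) =
      mfderiv 𝓘(ℝ, ℝ) 𝓘(ℝ, E) (fun t : ℝ ↦ m.act (Real.exp t) (φ.symm z)) 0 (1 : ℝ) := rfl
  rw [hgen, hfin]
  show _ = mfderiv 𝓘(ℝ, E) 𝓘(ℝ, E) φ.symm z ((1 : ℝ) • m.generatorCoord φ z)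
  rw [one_smul]

/-- In a chart, the differential of the action of `c` is the partial derivative of the flow. -/
theorem mfderiv_chart_symm_fderiv_flowCoord (m : FreePosRealAction E M)
    (hφ : φ ∈ IsManifold.maximalAtlas 𝓘(ℝ, E) ∞ M) {c : ℝ} (hc : 0 < c) {z : E}
    (hz : z ∈ φ.target) (hcz : m.act c (φ.symm z) ∈ φ.source) (u : E) :
    (mfderiv 𝓘(ℝ, E) 𝓘(ℝ, E) φ.symm (m.flowCoord φ (c, z)) : E →L[ℝ] E)
        (fderiv ℝ (m.flowCoord φ) (c, z) (0, u)) =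
      (mfderiv 𝓘(ℝ, E) 𝓘(ℝ, E) (m.act c) (φ.symm z) : E →L[ℝ] E)
        ((mfderiv 𝓘(ℝ, E) 𝓘(ℝ, E) φ.symm z : E →L[ℝ] E) u) := by
  have hd : HasFDerivAt (fun y ↦ m.flowCoord φ (c, y))
      ((fderiv ℝ (m.flowCoord φ) (c, z)).comp (ContinuousLinearMap.inr ℝ ℝ E)) z :=
    HasFDerivAt.comp z ((m.contDiffAt_flowCoord hφ hc hz hcz).differentiableAt
      (by simp)).hasFDerivAt (hasFDerivAt_prodMk_right c z)
  have hs : ∀ y ∈ φ.target,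
      HasMFDerivAt 𝓘(ℝ, E) 𝓘(ℝ, E) φ.symm y (mfderiv 𝓘(ℝ, E) 𝓘(ℝ, E) φ.symm y) := fun y hy ↦
    (((contMDiffOn_symm_of_mem_maximalAtlas hφ).contMDiffAt
      (φ.open_target.mem_nhds hy)).mdifferentiableAt (by simp)).hasMFDerivAt
  have h1 := HasMFDerivAt.comp z (hs (m.flowCoord φ (c, z)) (φ.map_source hcz)) hd.hasMFDerivAt
  have h2 := HasMFDerivAt.comp z
    (((m.contMDiff_act hc).mdifferentiable (by simp)) (φ.symm z)).hasMFDerivAt (hs z hz)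
  have hev : (φ.symm ∘ fun y ↦ m.flowCoord φ (c, y)) =ᶠ[𝓝 z] (m.act c ∘ φ.symm) := by
    have hc' : Filter.Tendsto (fun y : E ↦ (c, y)) (𝓝 z) (𝓝 (c, z)) :=
      (continuous_const.prodMk continuous_id).tendsto z
    filter_upwards [hc'.eventually (m.chart_symm_flowCoord_eventuallyEq hφ hc hz hcz)] with y hy
      using hy.2.2.2
  have h3 := h1.mfderiv.symm.trans (hev.mfderiv_eq.trans h2.mfderiv)
  exact DFunLike.congr_fun h3 u

/-- Symmetry of second derivatives: the time derivative of the differential of the flow is the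
differential of the generator. -/
theorem hasDerivAt_fderiv_flowCoord (m : FreePosRealAction E M)
    (hφ : φ ∈ IsManifold.maximalAtlas 𝓘(ℝ, E) ∞ M) {z : E} (hz : z ∈ φ.target) (u : E) :
    HasDerivAt (fun c : ℝ ↦ fderiv ℝ (m.flowCoord φ) (c, z) (0, u))
      (fderiv ℝ (m.generatorCoord φ) z u) 1 := by
  have hΦ := m.contDiffAt_flowCoord_one hφ hz
  have hD : HasFDerivAt (fderiv ℝ (m.flowCoord φ)) (fderiv ℝ (fderiv ℝ (m.flowCoord φ)) (1, z))
      (1, z) :=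
    ((hΦ.fderiv_right (m := ∞) le_rfl).differentiableAt (by simp)).hasFDerivAt
  have hsymm := hΦ.isSymmSndFDerivAt (by
    rw [minSmoothness_of_isRCLikeNormedField]; exact WithTop.coe_le_coe.mpr le_top)
  have h1 : HasDerivAt (fun c : ℝ ↦ fderiv ℝ (m.flowCoord φ) (c, z))
      (fderiv ℝ (fderiv ℝ (m.flowCoord φ)) (1, z) (1, 0)) 1 :=
    hD.comp_hasDerivAt (1 : ℝ) ((hasDerivAt_id (1 : ℝ)).prodMk (hasDerivAt_const (1 : ℝ) z))
  have h2 : HasFDerivAt (m.generatorCoord φ)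
      (((fderiv ℝ (fderiv ℝ (m.flowCoord φ)) (1, z)).comp
        (ContinuousLinearMap.inr ℝ ℝ E)).flip (1, 0)) z := by
    have := HasFDerivAt.comp z hD (hasFDerivAt_prodMk_right (1 : ℝ) z)
    have h := this.clm_apply (hasFDerivAt_const ((1 : ℝ), (0 : E)) z)
    simp only [ContinuousLinearMap.comp_zero, zero_add] at h
    exact h
  rw [h2.fderiv]
  have h3 := h1.clm_apply (hasDerivAt_const (1 : ℝ) ((0 : ℝ), u))
  simpa [hsymm.eq (1, 0) (0, u)] using h3

theorem hasDerivAt_flowCoord (m : FreePosRealAction E M)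
    (hφ : φ ∈ IsManifold.maximalAtlas 𝓘(ℝ, E) ∞ M) {z : E} (hz : z ∈ φ.target) :
    HasDerivAt (fun c : ℝ ↦ m.flowCoord φ (c, z)) (m.generatorCoord φ z) 1 := by
  have hd := ((m.contDiffAt_flowCoord_one hφ hz).differentiableAt (by simp)).hasFDerivAt
  have := hd.comp_hasDerivAt (1 : ℝ) ((hasDerivAt_id (1 : ℝ)).prodMk (hasDerivAt_const (1 : ℝ) z))
  exact this

theorem fderiv_flowCoord_one (m : FreePosRealAction E M)
    (hφ : φ ∈ IsManifold.maximalAtlas 𝓘(ℝ, E) ∞ M) {z : E} (hz : z ∈ φ.target) (u : E) :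
    fderiv ℝ (m.flowCoord φ) (1, z) (0, u) = u := by
  have h1 := HasFDerivAt.comp z
    ((m.contDiffAt_flowCoord_one hφ hz).differentiableAt (by simp)).hasFDerivAt
    (hasFDerivAt_prodMk_right (1 : ℝ) z)
  have h2 : HasFDerivAt (m.flowCoord φ ∘ fun y ↦ ((1 : ℝ), y)) (ContinuousLinearMap.id ℝ E) z := by
    refine (hasFDerivAt_id z).congr_of_eventuallyEq ?_
    filter_upwards [φ.open_target.mem_nhds hz] with y hy using m.flowCoord_one hy
  exact DFunLike.congr_fun (h1.unique h2) u

/-- The parameter values near `1` for which the flow stays in the chart. -/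
theorem eventually_act_mem_source (m : FreePosRealAction E M)
    (hφ : φ ∈ IsManifold.maximalAtlas 𝓘(ℝ, E) ∞ M) {z : E} (hz : z ∈ φ.target) :
    ∀ᶠ c : ℝ in 𝓝 1, 0 < c ∧ m.act c (φ.symm z) ∈ φ.source := by
  have hc : Filter.Tendsto (fun c : ℝ ↦ (c, z)) (𝓝 1) (𝓝 (1, z)) :=
    (continuous_id.prodMk continuous_const).tendsto 1
  filter_upwards [hc.eventually (m.chart_symm_flowCoord_eventuallyEq hφ one_pos hz
      (by rw [m.one_act]; exact φ.map_target hz))] with c h using ⟨h.1, h.2.2.1⟩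

end FreePosRealAction

end Flow

/-! ### Infinitesimal homogeneity and the second derivative of f along geodesics. -/

section HomogeneousPair

variable {E : Type*} [NormedAddCommGroup E] [NormedSpace ℝ E]
  {M : Type*} [TopologicalSpace M] [ChartedSpace E M] [IsManifold 𝓘(ℝ, E) ∞ M]
  {φ : OpenPartialHomeomorph M E}
  {m : FreePosRealAction E M} {g : PseudoRiemannianMetric E M} {f : M → ℝ} {α : ℝ}

namespace IsHomogeneousPair

theorem contDiffAt_comp_chart_symm (h : IsHomogeneousPair m g f α)
    (hφ : φ ∈ IsManifold.maximalAtlas 𝓘(ℝ, E) ∞ M) {z : E} (hz : z ∈ φ.target) :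
    ContDiffAt ℝ ∞ (fun y ↦ f (φ.symm y)) z :=
  contMDiffAt_iff_contDiffAt.mp (ContMDiffAt.comp z (h.smooth (φ.symm z))
    ((contMDiffOn_symm_of_mem_maximalAtlas hφ).contMDiffAt (φ.open_target.mem_nhds hz)))

theorem fderiv_comp_chart_symm (h : IsHomogeneousPair m g f α)
    (hφ : φ ∈ IsManifold.maximalAtlas 𝓘(ℝ, E) ∞ M) {z : E} (hz : z ∈ φ.target) (v : E) :
    fderiv ℝ (fun y ↦ f (φ.symm y)) z v =
      mfderiv 𝓘(ℝ, E) 𝓘(ℝ, ℝ) f (φ.symm z) (mfderiv 𝓘(ℝ, E) 𝓘(ℝ, E) φ.symm z v) := by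
  have hs : MDifferentiableAt 𝓘(ℝ, E) 𝓘(ℝ, E) φ.symm z :=
    ((contMDiffOn_symm_of_mem_maximalAtlas hφ).contMDiffAt
      (φ.open_target.mem_nhds hz)).mdifferentiableAt (by simp)
  have hf := (h.smooth (φ.symm z)).mdifferentiableAt (by simp)
  rw [← mfderiv_eq_fderiv]
  exact DFunLike.congr_fun (mfderiv_comp z hf hs) v

/-- The relation `g (P, ·) = df` in a chart. -/
theorem coord_generatorCoord (h : IsHomogeneousPair m g f α)
    (hφ : φ ∈ IsManifold.maximalAtlas 𝓘(ℝ, E) ∞ M) {z : E} (hz : z ∈ φ.target) (v : E) :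
    g.coord φ (m.generatorCoord φ z) v z = fderiv ℝ (fun y ↦ f (φ.symm y)) z v := by
  rw [h.fderiv_comp_chart_symm hφ hz, ← h.metric_generator, PseudoRiemannianMetric.coord,
    m.mfderiv_chart_symm_generatorCoord hφ hz]

/-- Euler's relation `df (P) = α f` in a chart. -/
theorem fderiv_generatorCoord (h : IsHomogeneousPair m g f α)
    (hφ : φ ∈ IsManifold.maximalAtlas 𝓘(ℝ, E) ∞ M) {z : E} (hz : z ∈ φ.target) :
    fderiv ℝ (fun y ↦ f (φ.symm y)) z (m.generatorCoord φ z) = α * f (φ.symm z) := by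
  have hF : HasFDerivAt (fun y ↦ f (φ.symm y)) (fderiv ℝ (fun y ↦ f (φ.symm y)) z)
      (m.flowCoord φ (1, z)) := by
    rw [m.flowCoord_one hz]
    exact ((h.contDiffAt_comp_chart_symm hφ hz).differentiableAt (by simp)).hasFDerivAt
  have h1 := hF.comp_hasDerivAt (1 : ℝ) (m.hasDerivAt_flowCoord hφ hz)
  have h2 : HasDerivAt (fun c : ℝ ↦ c ^ α * f (φ.symm z)) (α * f (φ.symm z)) 1 := by
    simpa using (Real.hasDerivAt_rpow_const (x := 1) (p := α) (by simp)).mul_const (f (φ.symm z))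
  refine h1.unique (h2.congr_of_eventuallyEq ?_)
  filter_upwards [m.eventually_act_mem_source hφ hz] with c hc
  simp only [Function.comp, FreePosRealAction.flowCoord, φ.left_inv hc.2]
  exact h.pullback_fun c hc.1 _

/-- The relation `L_P g = α g` in a chart. -/
theorem lieDerivative_coord (h : IsHomogeneousPair m g f α)
    (hφ : φ ∈ IsManifold.maximalAtlas 𝓘(ℝ, E) ∞ M) {z : E} (hz : z ∈ φ.target) (u : E) :
    fderiv ℝ (g.coord φ u u) z (m.generatorCoord φ z) +
      2 * g.coord φ (fderiv ℝ (m.generatorCoord φ) z u) u z = α * g.coord φ u u z := by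
  -- The function c ↦ (act_c^* g)(u, u) is differentiated at c = 1 in two ways: by the Leibniz rule
  -- along the flow, and as c^α g(u, u).
  have hu := m.hasDerivAt_fderiv_flowCoord hφ hz u
  have h1 := g.hasDerivAt_coord hφ (m.hasDerivAt_flowCoord hφ hz) hu hu
    (by rwa [m.flowCoord_one hz])
  rw [m.fderiv_flowCoord_one hφ hz, m.flowCoord_one hz] at h1
  have h2 : HasDerivAt (fun c : ℝ ↦ c ^ α * g.coord φ u u z) (α * g.coord φ u u z) 1 := by
    simpa using (Real.hasDerivAt_rpow_const (x := 1) (p := α) (by simp)).mul_const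
      (g.coord φ u u z)
  have h3 := h1.unique (h2.congr_of_eventuallyEq (by
    filter_upwards [m.eventually_act_mem_source hφ hz] with c hc
    have e := m.mfderiv_chart_symm_fderiv_flowCoord hφ hc.1 hz hc.2 u
    refine Eq.trans ?_ (h.pullback_metric c hc.1 (φ.symm z) _ _)
    refine (g.inner_congr_base (φ.left_inv hc.2) _ _).trans ?_
    exact congrArg (fun w : E ↦ (g.inner (m.act c (φ.symm z)) : E →L[ℝ] E →L[ℝ] ℝ) w w) e))
  rw [g.coord_symm u] at h3
  linarith

/-- The second derivative of `f` along a geodesic of `f ^ β g`. -/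
theorem deriv_deriv_comp_geodesic (h : IsHomogeneousPair m g f α) {β : ℝ} {γ : ℝ → M} {J : Set ℝ}
    (hJ : IsOpen J) (hγ : (h.powMetric β).IsGeodesicOn γ J) {t : ℝ} (ht : t ∈ J) :
    ∃ (X : TangentSpace 𝓘(ℝ, E) (γ t)) (r : ℝ), r = mfderiv 𝓘(ℝ, E) 𝓘(ℝ, ℝ) f (γ t) X ∧
      deriv (deriv fun s ↦ f (γ s)) t =
        α * (1 + β) / 2 * g.inner (γ t) X X - β * r ^ 2 / f (γ t) := by
  set φ := chartAt E (γ t) with hφdef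
  have hφ : φ ∈ IsManifold.maximalAtlas 𝓘(ℝ, E) ∞ M := IsManifold.chart_mem_maximalAtlas _
  have hsrc : γ t ∈ φ.source := mem_chart_source E (γ t)
  have htgt : φ (γ t) ∈ φ.target := φ.map_source hsrc
  set c : ℝ → E := fun s ↦ φ (γ s) with hc
  set F : E → ℝ := fun y ↦ f (φ.symm y) with hF
  set p := m.generatorCoord φ with hp
  have hJt := hJ.mem_nhds ht
  have hγs : ∀ s ∈ J, ContMDiffAt 𝓘(ℝ, ℝ) 𝓘(ℝ, E) ∞ γ s := fun s hs ↦
    hγ.1.contMDiffAt (hJ.mem_nhds hs)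
  have hcs : ∀ s ∈ J, γ s ∈ φ.source → ContDiffAt ℝ ∞ c s := fun s hs hs' ↦
    contMDiffAt_iff_contDiffAt.mp (ContMDiffAt.comp s
      ((contMDiffOn_of_mem_maximalAtlas hφ).contMDiffAt (φ.open_source.mem_nhds hs')) (hγs s hs))
  have hev : ∀ᶠ s in 𝓝 t, s ∈ J ∧ γ s ∈ φ.source :=
    Filter.Eventually.and hJt ((hγs t ht).continuousAt.eventually (φ.open_source.mem_nhds hsrc))
  have hct := hcs t ht hsrc
  have hd1 : HasDerivAt c (deriv c t) t := (hct.differentiableAt (by simp)).hasDerivAt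
  have hd2 : HasDerivAt (deriv c) (deriv (deriv c) t) t := by
    have : ContDiffAt ℝ ∞ (deriv c) t := by
      have h' := (hct.fderiv_right (m := ∞) le_rfl).clm_apply (contDiffAt_const (c := (1 : ℝ)))
      exact h'
    exact (this.differentiableAt (by simp)).hasDerivAt
  -- The first derivative is df(γ') = g(P, γ'), needed on a neighbourhood in order to be
  -- differentiated again.
  have hfirst : (deriv fun s ↦ f (γ s)) =ᶠ[𝓝 t] fun s ↦ g.coord φ (p (c s)) (deriv c s) (c s) := by
    filter_upwards [hev.eventually_nhds] with s hs
    obtain ⟨hsJ, hss⟩ := hs.self_of_nhds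
    have hcst : c s ∈ φ.target := φ.map_source hss
    rw [h.coord_generatorCoord hφ hcst]
    have e : (fun s ↦ f (γ s)) =ᶠ[𝓝 s] F ∘ c := by
      filter_upwards [hs] with r hr
      simp [F, c, φ.left_inv hr.2]
    rw [e.deriv_eq]
    exact (((h.contDiffAt_comp_chart_symm hφ hcst).differentiableAt
      (by simp)).hasFDerivAt.comp_hasDerivAt s
        ((hcs s hsJ hss).differentiableAt (by simp)).hasDerivAt).deriv
  set z := c t with hz
  set u := deriv c t with hu
  have hpc : HasDerivAt (fun s ↦ p (c s)) (fderiv ℝ p z u) t := by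
    have hp' := ((m.contDiffAt_generatorCoord hφ htgt).differentiableAt (by simp)).hasFDerivAt
    exact hp'.comp_hasDerivAt t hd1
  have hsecond := (g.hasDerivAt_coord hφ hd1 hpc hd2 htgt).deriv
  rw [hfirst.deriv_eq, hsecond]
  have hFz : F z = f (γ t) := by simp [F, z, c, φ.left_inv hsrc]
  have hFpos : 0 < F z := h.pos _
  have hFd : HasFDerivAt F (fderiv ℝ F z) z :=
    ((h.contDiffAt_comp_chart_symm hφ htgt).differentiableAt (by simp)).hasFDerivAt
  have hcoord : ∀ a b : E, (h.powMetric β).coord φ a b = fun y ↦ F y ^ β * g.coord φ a b y :=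
    fun a b ↦ rfl
  have hdiff : ∀ a b v : E, fderiv ℝ ((h.powMetric β).coord φ a b) z v =
      F z ^ β * (fderiv ℝ (g.coord φ a b) z v + β * fderiv ℝ F z v * g.coord φ a b z / F z) := by
    intro a b v
    have hg : HasFDerivAt (g.coord φ a b) (fderiv ℝ (g.coord φ a b) z) z :=
      ((g.contDiffAt_coord hφ contDiffAt_id contDiffAt_const contDiffAt_const
        htgt).differentiableAt (by simp)).hasFDerivAt
    have hprod : HasFDerivAt (fun y ↦ F y ^ β * g.coord φ a b y) _ z :=
      (hFd.rpow_const (p := β) (Or.inl hFpos.ne')).mul hg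
    rw [hcoord, hprod.fderiv]
    simp [Real.rpow_sub_one hFpos.ne']
    field_simp
  -- The geodesic equation is tested against P, frozen at its value at z, since g(P, c'') is the
  -- term to eliminate.
  have hgeo := hγ.2 φ hφ t ht hsrc (p z)
  have hgeo' : F z ^ β * (g.coord φ (deriv (deriv c) t) (p z) z +
      (fderiv ℝ (g.coord φ u (p z)) z u + β * fderiv ℝ F z u * g.coord φ u (p z) z / F z) -
      (fderiv ℝ (g.coord φ u u) z (p z) +
        β * fderiv ℝ F z (p z) * g.coord φ u u z / F z) / 2) = 0 := by
    rw [← hgeo]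
    show _ = (h.powMetric β).coord φ (deriv (deriv c) t) (p z) z +
      (h.powMetric β).christoffel φ u u (p z) z
    rw [PseudoRiemannianMetric.christoffel, hdiff, hdiff, hcoord]
    ring
  have hgeo'' := (mul_eq_zero.mp hgeo').resolve_left (Real.rpow_pos_of_pos hFpos β).ne'
  have hlie := h.lieDerivative_coord hφ htgt u
  have heuler := h.fderiv_generatorCoord hφ htgt
  have hpu := h.coord_generatorCoord hφ htgt u
  have hsymm : g.coord φ (p z) u = g.coord φ u (p z) := funext fun y ↦ g.coord_symm _ _ y
  change fderiv ℝ (g.coord φ u u) z (p z) + 2 * g.coord φ (fderiv ℝ p z u) u z =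
    α * g.coord φ u u z at hlie
  change fderiv ℝ F z (p z) = α * F z at heuler
  change g.coord φ (p z) u z = fderiv ℝ F z u at hpu
  rw [hsymm] at hpu
  -- The terms ∂_u g(P, u) cancel. The remaining g(∂_u P, u) + ½ ∂_P g(u, u) is half of (L_P g)(u,
  -- u) = α g(u, u), and Euler's relation turns the conformal term into αβ/2 · g(u, u).
  have hfin : fderiv ℝ (g.coord φ (p z) u) z u + g.coord φ (fderiv ℝ p z u) u z +
      g.coord φ (p z) (deriv (deriv c) t) z =
      α * (1 + β) / 2 * g.coord φ u u z - β * (fderiv ℝ F z u) ^ 2 / F z := by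
    rw [g.coord_symm (p z), hsymm]
    rw [hpu, heuler] at hgeo''
    have e1 : β * (α * F z) * g.coord φ u u z / F z = β * α * g.coord φ u u z := by
      field_simp
    rw [e1] at hgeo''
    have e2 : β * fderiv ℝ F z u * fderiv ℝ F z u / F z = β * (fderiv ℝ F z u) ^ 2 / F z := by
      ring
    linarith
  have hbase : φ.symm z = γ t := φ.left_inv hsrc
  refine ⟨(mfderiv 𝓘(ℝ, E) 𝓘(ℝ, E) φ.symm z : E →L[ℝ] E) u, _, rfl, hfin.trans ?_⟩
  rw [h.fderiv_comp_chart_symm hφ htgt, hFz]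
  have hm : ∀ {x y : M} (_ : x = y) (v : E), (mfderiv 𝓘(ℝ, E) 𝓘(ℝ, ℝ) f x : E →L[ℝ] ℝ) v =
      (mfderiv 𝓘(ℝ, E) 𝓘(ℝ, ℝ) f y : E →L[ℝ] ℝ) v := fun hxy v ↦ by subst hxy; rfl
  have e1 := hm hbase ((mfderiv 𝓘(ℝ, E) 𝓘(ℝ, E) φ.symm z : E →L[ℝ] E) u)
  have e2 := g.inner_congr_base hbase ((mfderiv 𝓘(ℝ, E) 𝓘(ℝ, E) φ.symm z : E →L[ℝ] E) u)
    ((mfderiv 𝓘(ℝ, E) 𝓘(ℝ, E) φ.symm z : E →L[ℝ] E) u)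
  exact congrArg₂ (fun r s : ℝ ↦ α * (1 + β) / 2 * r - β * s ^ 2 / f (γ t)) e2 e1

theorem mfderiv_generator (h : IsHomogeneousPair m g f α) (x : M) :
    mfderiv 𝓘(ℝ, E) 𝓘(ℝ, ℝ) f x (m.generator x) = α * f x := by
  have hφ : chartAt E x ∈ IsManifold.maximalAtlas 𝓘(ℝ, E) ∞ M :=
    IsManifold.chart_mem_maximalAtlas _
  have hx : chartAt E x x ∈ (chartAt E x).target := mem_chart_target E x
  have e := h.fderiv_generatorCoord hφ hx
  rw [h.fderiv_comp_chart_symm hφ hx, m.mfderiv_chart_symm_generatorCoord hφ hx,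
    (chartAt E x).left_inv (mem_chart_source E x)] at e
  exact e

/-- The square of a vector in terms of its component tangent to the level set of `f`. -/
theorem exists_levelForm_eq (h : IsHomogeneousPair m g f α) (x : M)
    (X : TangentSpace 𝓘(ℝ, E) x) (r : ℝ) (hr : r = mfderiv 𝓘(ℝ, E) 𝓘(ℝ, ℝ) f x X) :
    ∃ Y : levelTangent (E := E) f x, g.levelForm f x Y Y = g.inner x X X - r ^ 2 / (α * f x) := by
  have hf := (h.pos x).ne'
  have hα := h.degree_ne_zero
  set P := m.generator x
  have hP := h.mfderiv_generator x
  -- By Euler's relation this is the multiple of P whose removal puts X in the kernel of df.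
  let k : ℝ := r / (α * f x)
  have hY : mfderiv 𝓘(ℝ, E) 𝓘(ℝ, ℝ) f x (X - k • P) = 0 := by
    rw [map_sub, map_smul, hP, ← hr]
    show r - k * (α * f x) = 0
    simp only [k]; field_simp; ring
  have hPP : g.inner x P P = α * f x := (h.metric_generator x P).trans hP
  have hPX : g.inner x P X = r := (h.metric_generator x X).trans hr.symm
  have hXP : g.inner x X P = r := (g.symm x X P).trans hPX
  refine ⟨⟨X - k • P, hY⟩, ?_⟩
  show g.inner x (X - k • P) (X - k • P) = _
  simp only [map_sub, map_smul, sub_apply, smul_apply, hPP, hPX, hXP, smul_eq_mul]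
  simp only [k]; field_simp; ring

/-- The second derivative of `f` along a geodesic of `f ^ β g`, in terms of the component of the
velocity tangent to the level set of `f`. -/
theorem exists_deriv_deriv_comp_geodesic_eq (h : IsHomogeneousPair m g f α) {β : ℝ} {γ : ℝ → M}
    {J : Set ℝ} (hJ : IsOpen J) (hγ : (h.powMetric β).IsGeodesicOn γ J) {t : ℝ} (ht : t ∈ J) :
    ∃ (Y : levelTangent (E := E) f (γ t)) (r : ℝ), deriv (deriv fun s ↦ f (γ s)) t =
      (1 - β) / 2 * (r ^ 2 / f (γ t)) + (1 + β) / 2 * (α * g.levelForm f (γ t) Y Y) := by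
  obtain ⟨X, r, hr, hX⟩ := h.deriv_deriv_comp_geodesic hJ hγ ht
  obtain ⟨Y, hY⟩ := h.exists_levelForm_eq (γ t) X r hr
  have hf := (h.pos (γ t)).ne'
  have hα := h.degree_ne_zero
  refine ⟨Y, r, ?_⟩
  rw [hX, hY]
  field_simp
  ring

/-- Each level set can be moved to the level `l` by the action, which scales the induced metric. -/
theorem exists_level_transport (h : IsHomogeneousPair m g f α) {l : ℝ} (hl : 0 < l) (x : M)
    (u : levelTangent (E := E) f x) (hu : u ≠ 0) :
    ∃ (y : M) (v : levelTangent (E := E) f y) (r : ℝ), f y = l ∧ v ≠ 0 ∧ 0 < r ∧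
      g.levelForm f y v v = r * g.levelForm f x u u := by
  have hx := h.pos x
  have hα := h.degree_ne_zero
  have hlx : 0 < l / f x := div_pos hl hx
  -- Solvable because α ≠ 0; this c moves the level f x to l.
  obtain ⟨c, hc, hcα⟩ : ∃ c : ℝ, 0 < c ∧ c ^ α = l / f x :=
    ⟨(l / f x) ^ α⁻¹, Real.rpow_pos_of_pos hlx _, Real.rpow_inv_rpow hlx.le hα⟩
  have hact : MDifferentiableAt 𝓘(ℝ, E) 𝓘(ℝ, E) (m.act c) x :=
    (m.contMDiff_act hc).mdifferentiable (by simp) x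
  have hf : MDifferentiableAt 𝓘(ℝ, E) 𝓘(ℝ, ℝ) f (m.act c x) :=
    h.smooth.mdifferentiable (by simp) _
  have hfx : MDifferentiableAt 𝓘(ℝ, E) 𝓘(ℝ, ℝ) f x := h.smooth.mdifferentiable (by simp) _
  set T := mfderiv 𝓘(ℝ, E) 𝓘(ℝ, E) (m.act c) x with hT
  have hker : mfderiv 𝓘(ℝ, E) 𝓘(ℝ, ℝ) f (m.act c x) (T u.1) = 0 := by
    have h1 : mfderiv 𝓘(ℝ, E) 𝓘(ℝ, ℝ) (f ∘ m.act c) x =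
        (mfderiv 𝓘(ℝ, E) 𝓘(ℝ, ℝ) f (m.act c x)).comp T := mfderiv_comp x hf hact
    have h2 : f ∘ m.act c = c ^ α • f := funext fun y ↦ h.pullback_fun c hc y
    have h3 := const_smul_mfderiv hfx (c ^ α)
    rw [← h2, h1] at h3
    have h4 := DFunLike.congr_fun h3 u.1
    have h5 : mfderiv 𝓘(ℝ, E) 𝓘(ℝ, ℝ) f x u.1 = 0 := u.2
    refine h4.trans ?_
    show c ^ α • (mfderiv 𝓘(ℝ, E) 𝓘(ℝ, ℝ) f x u.1) = 0
    rw [h5, smul_zero]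
  refine ⟨m.act c x, ⟨T u.1, hker⟩, c ^ α, ?_, ?_, Real.rpow_pos_of_pos hc α,
    h.pullback_metric c hc x u.1 u.1⟩
  · rw [h.pullback_fun c hc, hcα, div_mul_cancel₀ _ hx.ne']
  -- The differential of the action is injective: if it kills u, then c^α g(u, w) = 0 for all w, and
  -- g is nondegenerate.
  · intro h0
    have h1 : T u.1 = 0 := congrArg Subtype.val h0
    refine hu (Subtype.ext (g.nondegenerate x u.1 fun w ↦ ?_))
    have h2 := h.pullback_metric c hc x u.1 w
    rw [← hT, h1, map_zero] at h2
    exact (mul_eq_zero.mp h2.symm).resolve_left (Real.rpow_pos_of_pos hc α).ne'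

theorem levelForm_nonneg (h : IsHomogeneousPair m g f α) {l : ℝ} (hl : 0 < l) {a : ℝ}
    (hpos : g.LevelPosDef f l a) (x : M) (u : levelTangent (E := E) f x) :
    0 ≤ a * g.levelForm f x u u := by
  by_cases hu : u = 0
  · simp [hu, PseudoRiemannianMetric.levelForm]
  obtain ⟨y, v, r, hy, hv, hr, e⟩ := h.exists_level_transport hl x u hu
  have h1 := hpos y hy v hv
  rw [e, mul_left_comm] at h1
  exact (pos_of_mul_pos_right h1 hr.le).le

theorem levelForm_nonpos (h : IsHomogeneousPair m g f α) {l : ℝ} (hl : 0 < l) {a : ℝ}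
    (hneg : g.LevelNegDef f l a) (x : M) (u : levelTangent (E := E) f x) :
    a * g.levelForm f x u u ≤ 0 := by
  have := h.levelForm_nonneg hl (a := -a)
    (fun y hy v hv ↦ by have := hneg y hy v hv; linarith) x u
  linarith

theorem contDiffOn_comp_geodesic (h : IsHomogeneousPair m g f α) {β : ℝ} {γ : ℝ → M}
    {J : Set ℝ} (hγ : (h.powMetric β).IsGeodesicOn γ J) :
    ContDiffOn ℝ ∞ (fun t ↦ f (γ t)) J :=
  contMDiffOn_iff_contDiffOn.mp (h.smooth.comp_contMDiffOn hγ.1)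

end IsHomogeneousPair

end HomogeneousPair

/-! ### Sign discussion. -/

theorem proposition3p17
    {E : Type*} [NormedAddCommGroup E] [NormedSpace ℝ E] [CompleteSpace E]
    {M : Type*} [TopologicalSpace M] [ChartedSpace E M] [IsManifold 𝓘(ℝ, E) ∞ M]
    (m : FreePosRealAction E M) (g : PseudoRiemannianMetric E M) (f : M → ℝ) (α : ℝ)
    (h : IsHomogeneousPair m g f α) (l : ℝ) (hl : 0 < l) (β : ℝ) :
    ((β = -1 ∨ (-1 < β ∧ β ≤ 1 ∧ g.LevelPosDef f l α) ∨ (β < -1 ∧ g.LevelNegDef f l α)) →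
      (h.powMetric β).GeodesicallyConvex f) ∧
    ((1 ≤ β ∧ g.LevelNegDef f l α) → (h.powMetric β).GeodesicallyConcave f) := by
  have hdiff : ∀ (J : Set ℝ) (γ : ℝ → M), IsOpen J → (h.powMetric β).IsGeodesicOn γ J →
      DifferentiableOn ℝ (fun t ↦ f (γ t)) J ∧
        DifferentiableOn ℝ (deriv fun t ↦ f (γ t)) J := fun J γ hJ hγ ↦
    have hs := h.contDiffOn_comp_geodesic hγ
    ⟨hs.differentiableOn (by simp),
      (hs.deriv_of_isOpen (m := ∞) hJ le_rfl).differentiableOn (by simp)⟩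
  constructor
  · intro hβ J γ hJ hJc hγ
    obtain ⟨d1, d2⟩ := hdiff J γ hJ hγ
    refine convexOn_of_deriv2_nonneg' hJc.convex d1 d2 fun t ht ↦ ?_
    obtain ⟨Y, r, e⟩ := h.exists_deriv_deriv_comp_geodesic_eq hJ hγ ht
    show 0 ≤ deriv (deriv fun s ↦ f (γ s)) t
    rw [e]
    have hr : 0 ≤ r ^ 2 / f (γ t) := div_nonneg (sq_nonneg r) (h.pos _).le
    rcases hβ with rfl | ⟨h1, h2, hp⟩ | ⟨h1, hn⟩
    -- At β = -1 the tangential term has coefficient zero, so no definiteness is needed.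
    · norm_num [hr]
    · exact add_nonneg (mul_nonneg (by linarith) hr)
        (mul_nonneg (by linarith) (h.levelForm_nonneg hl hp _ Y))
    · exact add_nonneg (mul_nonneg (by linarith) hr)
        (mul_nonneg_of_nonpos_of_nonpos (by linarith) (h.levelForm_nonpos hl hn _ Y))
  · rintro ⟨hβ, hn⟩ J γ hJ hJc hγ
    obtain ⟨d1, d2⟩ := hdiff J γ hJ hγ
    refine concaveOn_of_deriv2_nonpos' hJc.convex d1 d2 fun t ht ↦ ?_
    obtain ⟨Y, r, e⟩ := h.exists_deriv_deriv_comp_geodesic_eq hJ hγ ht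
    show deriv (deriv fun s ↦ f (γ s)) t ≤ 0
    rw [e]
    have hr : 0 ≤ r ^ 2 / f (γ t) := div_nonneg (sq_nonneg r) (h.pos _).le
    exact add_nonpos (mul_nonpos_of_nonpos_of_nonneg (by linarith) hr)
      (mul_nonpos_of_nonneg_of_nonpos (by linarith) (h.levelForm_nonpos hl hn _ Y))
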